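/- Let $\mathbb K$ be a field and $\mathbb K[\mathbf x]=\mathbb K[x_1,\dots,x_n]$. For a term order $\prec$, $\mathrm{in}_\prec(I)$ is the ideal generated by the $\prec$-leading terms of the elements of an ideal $I$; for $w\in\mathbb N^n$, $\mathrm{in}_w(I)$ is the ideal generated by the initial forms $\mathrm{in}_w(f)$, $f\in I$, where $\mathrm{in}_w(f)$ is the sum of the terms of $f$ of maximal $w$-weight. An ideal $I\subseteq\mathbb K[\mathbf x]$ is called an edge providing ideal if the set $\{\mathrm{in}_\prec(I)\}$ of its initial monomial ideals, as $\prec$ ranges over all term orders, has exactly two elements. It is called an edge ideal if there is $c\in\mathbb Z^n$ with both positive and negative coordinates such that $I$ is homogeneous for the $(\mathbb Z^n/\mathbb Z c)$-grading of $\mathbb K[\mathbf x]$ in which $x_i$ has degree the class of the unit vector $e_i$. (1) Every edge ideal that is not a monomial ideal is an edge providing ideal. (2) Let $I$ be an edge providing ideal. Then among the initial ideals $\mathrm{in}_w(I)$, where $w\in\mathbb N^n$ has all coordinates positive, there is exactly one ideal $\widetilde I$ that is not a monomial ideal. Moreover, $\widetilde I$ is an edge ideal, and it has the same two initial monomial ideals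 as $I$. -/

import Mathlib

noncomputable section

namespace EdgeIdeals

variable {n : ℕ} {K : Type*} [Field K]

/-- A monomial ideal: an ideal generated by a (possibly empty) set of monomials. -/
def IsMonomialIdeal (I : Ideal (MvPolynomial (Fin n) K)) : Prop :=
  ∃ S : Set (Fin n →₀ ℕ),
    I = Ideal.span ((fun u => MvPolynomial.monomial u (1 : K)) '' S)

/-- The initial ideal of `I` with respect to a term order: the ideal generated by the leading
terms of all elements of `I` (the leading term of `0` is `0`). -/
def initialIdeal (m : MonomialOrder.{0, 0} (Fin n)) (I : Ideal (MvPolynomial (Fin n) K)) :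
    Ideal (MvPolynomial (Fin n) K) :=
  Ideal.span {g | ∃ f ∈ I, g = m.leadingTerm f}

/-- The set of initial monomial ideals of `I`, as the term order ranges over all term orders.
Term orders are taken with underlying types in `Type`; this is no restriction, because every term
order can be carried over to the exponent set `Fin n →₀ ℕ`. -/
def initialIdeals (I : Ideal (MvPolynomial (Fin n) K)) : Set (Ideal (MvPolynomial (Fin n) K)) :=
  {J | ∃ m : MonomialOrder.{0, 0} (Fin n), J = initialIdeal m I}

/-- An edge providing ideal: one with exactly two initial monomial ideals. -/
def IsEdgeProviding (I : Ideal (MvPolynomial (Fin n) K)) : Prop :=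
  (initialIdeals I).ncard = 2

/-- The degree of the variable `x i` in `ℤⁿ / ℤ c`: the class of the unit vector `e i`. -/
def cDegree (c : Fin n → ℤ) (i : Fin n) : (Fin n → ℤ) ⧸ AddSubgroup.zmultiples c :=
  QuotientAddGroup.mk (Pi.single i 1)

open Classical in
/-- `I` is homogeneous with respect to the grading of the polynomial ring by `ℤⁿ / ℤ c`. -/
def IsCHomogeneous (c : Fin n → ℤ) (I : Ideal (MvPolynomial (Fin n) K)) : Prop :=
  letI := MvPolynomial.weightedGradedAlgebra K (cDegree c)
  I.IsHomogeneous (MvPolynomial.weightedHomogeneousSubmodule K (cDegree c))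

/-- An edge ideal: homogeneous with respect to `ℤⁿ / ℤ c` for some `c` with both positive and
negative coordinates. -/
def IsEdgeIdeal (I : Ideal (MvPolynomial (Fin n) K)) : Prop :=
  ∃ c : Fin n → ℤ, (∃ i, 0 < c i) ∧ (∃ j, c j < 0) ∧ IsCHomogeneous c I

/-- The initial form of `f`: the sum of the terms of `f` of highest `w`-weight. -/
def initialForm (w : Fin n → ℕ) (f : MvPolynomial (Fin n) K) : MvPolynomial (Fin n) K :=
  MvPolynomial.weightedHomogeneousComponent w (MvPolynomial.weightedTotalDegree w f) f

/-- The weight initial ideal `in_w(I)`, generated by the initial forms of all elements of `I`. -/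
def weightInitialIdeal (w : Fin n → ℕ) (I : Ideal (MvPolynomial (Fin n) K)) :
    Ideal (MvPolynomial (Fin n) K) :=
  Ideal.span {g | ∃ f ∈ I, g = initialForm w f}

end EdgeIdeals

end

/-! An initial ideal is determined by its set of leading exponents. For a leading exponent s of I
under an order m, the reduced element is x^s minus its normal form. An order gives the same initial
ideal as m exactly when it selects s in each of these elements (`degree_reducedElement`,
`leadingExponents_eq_of_le_degree`).

(1) If I is homogeneous modulo ℤc, the exponents of a reduced element lie on one line s + ℤc. An
order therefore acts only through the sign it gives to c, and at most two initial ideals arise.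
Since c has both signs, distinct exponents of equal degree are incomparable. An order comparing a
suitable variable first can thus overturn any given tail term, so a single initial ideal would force
I to be monomial (`exists_leadingExponents_ne`).

(2) The two closed Gröbner cones (`Selects`) cover the positive weights. Leaving one along a segment
towards the other reaches a common point w (`exists_selects_both`), and in_w(I) keeps both initial
ideals because in_m(in_w(I)) is the initial ideal of I for w refined by m
(`leadingExponents_weightInitialIdeal`). Let d and e be differences of exponents that w ties, one
from each cone. A functional negative on both would push w out of both cones, so d and e are
antiparallel (`antiparallel_of_cover`). Hence all ties lie along one vector c, which has both signs
because it is orthogonal to the positive w. Antiparallelism also makes the ties the same at every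
common point with nonmonomial initial ideal, which gives uniqueness. -/

noncomputable section

namespace EdgeIdeals

open MvPolynomial MonomialOrder

variable {n : ℕ} {K : Type*} [Field K]

/-- The exponents of the leading monomials of the nonzero elements of `I`. -/
def leadingExponents (m : MonomialOrder.{0, 0} (Fin n)) (I : Ideal (MvPolynomial (Fin n) K)) :
    Set (Fin n →₀ ℕ) :=
  {s | ∃ f ∈ I, f ≠ 0 ∧ m.degree f = s}

/-! ### Leading exponents, normal forms and reduced elements -/

section Basic

variable {m m' : MonomialOrder.{0, 0} (Fin n)} {I J : Ideal (MvPolynomial (Fin n) K)}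

lemma leadingExponents_upward {s t : Fin n →₀ ℕ} (hs : s ∈ leadingExponents m I) (h : s ≤ t) :
    t ∈ leadingExponents m I := by
  obtain ⟨f, hf, h0, rfl⟩ := hs
  refine ⟨monomial (t - m.degree f) 1 * f, I.mul_mem_left _ hf, mul_ne_zero (by simp) h0, ?_⟩
  classical
  rw [degree_mul (by simp) h0, degree_monomial]
  simp [tsub_add_cancel_of_le h]

lemma initialIdeal_eq_span : initialIdeal m I =
    Ideal.span ((fun u => monomial u (1 : K)) '' leadingExponents m I) := by
  apply le_antisymm
  · refine Ideal.span_le.2 ?_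
    rintro _ ⟨f, hf, rfl⟩
    by_cases h0 : f = 0
    · simp [h0]
    have : m.leadingTerm f = C (m.leadingCoeff f) * monomial (m.degree f) 1 := by
      rw [C_mul_monomial, mul_one, leadingTerm]
    rw [this]
    exact Ideal.mul_mem_left _ _ (Ideal.subset_span ⟨_, ⟨f, hf, h0, rfl⟩, rfl⟩)
  · refine Ideal.span_le.2 ?_
    rintro _ ⟨_, ⟨f, hf, h0, rfl⟩, rfl⟩
    have : monomial (m.degree f) (1 : K) = C (m.leadingCoeff f)⁻¹ * m.leadingTerm f := by
      rw [leadingTerm, C_mul_monomial, inv_mul_cancel₀ (m.leadingCoeff_ne_zero_iff.2 h0)]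
    simp only [SetLike.mem_coe]
    rw [this]
    exact Ideal.mul_mem_left _ _ (Ideal.subset_span ⟨f, hf, rfl⟩)

lemma monomial_mem_initialIdeal {s : Fin n →₀ ℕ} :
    monomial s (1 : K) ∈ initialIdeal m I ↔ s ∈ leadingExponents m I := by
  classical
  rw [initialIdeal_eq_span, mem_ideal_span_monomial_image]
  simp only [support_monomial, one_ne_zero, if_false, Finset.mem_singleton, forall_eq]
  exact ⟨fun ⟨t, ht, hts⟩ => leadingExponents_upward ht hts, fun h => ⟨s, h, le_rfl⟩⟩

lemma initialIdeal_eq_iff : initialIdeal m I = initialIdeal m' J ↔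
    leadingExponents m I = leadingExponents m' J := by
  refine ⟨fun h => ?_, fun h => by rw [initialIdeal_eq_span, initialIdeal_eq_span, h]⟩
  ext s
  rw [← monomial_mem_initialIdeal, h, monomial_mem_initialIdeal]

lemma eq_zero_of_support_disjoint {f : MvPolynomial (Fin n) K} (hf : f ∈ I)
    (h : ∀ v ∈ f.support, v ∉ leadingExponents m I) : f = 0 := by
  by_contra h0
  exact h _ (m.degree_mem_support h0) ⟨f, hf, h0, rfl⟩

lemma degree_eq_of_support {f : MvPolynomial (Fin n) K} {s : Fin n →₀ ℕ} (hf : f ∈ I)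
    (h0 : f ≠ 0) (h : ∀ v ∈ f.support, v ∈ leadingExponents m I → v = s) : m.degree f = s :=
  h _ (m.degree_mem_support h0) ⟨f, hf, h0, rfl⟩

lemma exists_normalForm (m : MonomialOrder.{0, 0} (Fin n)) (I : Ideal (MvPolynomial (Fin n) K))
    (f : MvPolynomial (Fin n) K) :
    ∃ r, f - r ∈ I ∧ ∀ v ∈ r.support, v ∉ leadingExponents m I := by
  obtain ⟨g, r, hfr, -, hr⟩ := m.div_set (B := {b | b ∈ I ∧ b ≠ 0})
    (fun b hb => isUnit_iff_ne_zero.2 (m.leadingCoeff_ne_zero_iff.2 hb.2)) f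
  refine ⟨r, ?_, ?_⟩
  · rw [hfr, add_sub_cancel_right, Finsupp.linearCombination_apply]
    exact Submodule.sum_mem _ fun b _ => I.mul_mem_left _ b.2.1
  · rintro v hv ⟨b, hb, h0, rfl⟩
    exact hr _ hv b ⟨hb, h0⟩ le_rfl

/-- The normal form modulo I of an element of J again lies in J, but none of its exponents is a
leading exponent of J; so it vanishes. -/
lemma eq_of_le_of_leadingExponents (h : I ≤ J)
    (hE : leadingExponents m J ⊆ leadingExponents m I) : I = J := by
  refine le_antisymm h fun f hf => ?_
  obtain ⟨r, hr, hr'⟩ := exists_normalForm m I f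
  have hrJ : r ∈ J := by
    have := J.sub_mem hf (h hr)
    rwa [sub_sub_cancel] at this
  have : r = 0 := eq_zero_of_support_disjoint (m := m) hrJ fun v hv hv' => hr' v hv (hE hv')
  simpa [this] using hr

/-- The element `x ^ s - N` of `I` in which `N` is the normal form of `x ^ s`. -/
def reducedElement (m : MonomialOrder.{0, 0} (Fin n)) (I : Ideal (MvPolynomial (Fin n) K))
    (s : Fin n →₀ ℕ) : MvPolynomial (Fin n) K :=
  monomial s 1 - (exists_normalForm m I (monomial s 1)).choose

lemma reducedElement_mem (s : Fin n →₀ ℕ) : reducedElement m I s ∈ I :=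
  (exists_normalForm m I (monomial s 1)).choose_spec.1

lemma coeff_reducedElement_of_mem {s v : Fin n →₀ ℕ} (hv : v ∈ leadingExponents m I) :
    coeff v (reducedElement m I s) = if s = v then 1 else 0 := by
  classical
  have := (exists_normalForm m I (monomial s 1)).choose_spec.2 v
  rw [reducedElement, coeff_sub, coeff_monomial,
    notMem_support_iff.1 (fun h => this h hv), sub_zero]

lemma coeff_reducedElement_self {s : Fin n →₀ ℕ} (hs : s ∈ leadingExponents m I) :
    coeff s (reducedElement m I s) = 1 := by
  rw [coeff_reducedElement_of_mem hs, if_pos rfl]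

lemma reducedElement_ne_zero {s : Fin n →₀ ℕ} (hs : s ∈ leadingExponents m I) :
    reducedElement m I s ≠ 0 := by
  intro h
  have := coeff_reducedElement_self hs
  simp [h] at this

lemma eq_of_mem_support_reducedElement {s v : Fin n →₀ ℕ}
    (hv : v ∈ (reducedElement m I s).support) (hvE : v ∈ leadingExponents m I) : v = s := by
  by_contra h
  rw [mem_support_iff, coeff_reducedElement_of_mem hvE, if_neg (Ne.symm h)] at hv
  exact hv rfl

/-- Any order with the same leading exponents selects `s` in the reduced element of `s`. -/
lemma degree_reducedElement {s : Fin n →₀ ℕ} (hs : s ∈ leadingExponents m I)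
    (h : leadingExponents m' I = leadingExponents m I) :
    m'.degree (reducedElement m I s) = s :=
  degree_eq_of_support (I := I) (m := m') (reducedElement_mem s) (reducedElement_ne_zero hs)
    fun _ hv hvE => eq_of_mem_support_reducedElement hv (h ▸ hvE)

lemma lt_of_mem_support_reducedElement {s v : Fin n →₀ ℕ} (hs : s ∈ leadingExponents m I)
    (h : leadingExponents m' I = leadingExponents m I)
    (hv : v ∈ (reducedElement m I s).support) (hvs : v ≠ s) : m'.toSyn v < m'.toSyn s := by
  refine lt_of_le_of_ne ?_ (fun he => hvs (m'.toSyn.injective he))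
  have := m'.le_degree hv
  rwa [degree_reducedElement hs h] at this

/-- Were s an extra leading exponent for m', no exponent of its m'-reduced element would be a
leading exponent for m, so that nonzero element of I would vanish. -/
lemma leadingExponents_eq_of_subset
    (h : leadingExponents m I ⊆ leadingExponents m' I) :
    leadingExponents m I = leadingExponents m' I := by
  refine h.antisymm fun s hs => ?_
  by_contra hs'
  refine reducedElement_ne_zero hs
    (eq_zero_of_support_disjoint (m := m) (reducedElement_mem s) fun v hv hvE => hs' ?_)
  rwa [← eq_of_mem_support_reducedElement hv (h hvE)]

/-- If an order selects `s` in the reduced element of `s` for every minimal leading exponent `s`,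
then it yields the same leading exponents. -/
lemma leadingExponents_eq_of_le_degree {B : Set (Fin n →₀ ℕ)} (hB : B ⊆ leadingExponents m I)
    (hgen : ∀ s ∈ leadingExponents m I, ∃ b ∈ B, b ≤ s)
    (h : ∀ s ∈ B, ∀ v ∈ (reducedElement m I s).support, m'.toSyn v ≤ m'.toSyn s) :
    leadingExponents m' I = leadingExponents m I := by
  refine (leadingExponents_eq_of_subset fun s hs => ?_).symm
  obtain ⟨b, hb, hbs⟩ := hgen s hs
  refine leadingExponents_upward ?_ hbs
  refine ⟨_, reducedElement_mem (m := m) b, reducedElement_ne_zero (hB hb), ?_⟩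
  refine m'.toSyn.injective (le_antisymm (m'.degree_le_iff.2 (h b hb)) (m'.le_degree ?_))
  rw [mem_support_iff, coeff_reducedElement_self (hB hb)]
  exact one_ne_zero

end Basic

/-! ### Refining a weight to a term order -/

section Refine

/-- The type underlying the refinement of a weight by a term order. -/
def WeightSyn (_w : Fin n → ℕ) (_m : MonomialOrder.{0, 0} (Fin n)) : Type := Fin n →₀ ℕ

variable (w : Fin n → ℕ) (m : MonomialOrder.{0, 0} (Fin n))

instance : AddCommMonoid (WeightSyn w m) := inferInstanceAs (AddCommMonoid (Fin n →₀ ℕ))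

/-- The pair of the weight of an exponent and its position in the term order. -/
def weightSynKey (u : WeightSyn w m) : ℕ ×ₗ m.syn :=
  toLex (Finsupp.weight w (show Fin n →₀ ℕ from u), m.toSyn (show Fin n →₀ ℕ from u))

lemma weightSynKey_injective : Function.Injective (weightSynKey w m) := by
  intro a b h
  have := congrArg (fun x => (ofLex x).2) h
  exact m.toSyn.injective this

instance : LinearOrder (WeightSyn w m) :=
  LinearOrder.lift' (weightSynKey w m) (weightSynKey_injective w m)

lemma weightSyn_le_iff (a b : WeightSyn w m) : a ≤ b ↔ weightSynKey w m a ≤ weightSynKey w m b :=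
  Iff.rfl

lemma weightSynKey_add (a b : WeightSyn w m) :
    weightSynKey w m (a + b) = weightSynKey w m a + weightSynKey w m b := by
  have h1 := map_add (Finsupp.weight w) (show Fin n →₀ ℕ from a) (show Fin n →₀ ℕ from b)
  have h2 := map_add m.toSyn (show Fin n →₀ ℕ from a) (show Fin n →₀ ℕ from b)
  exact congrArg toLex (Prod.ext h1 h2)

instance : IsOrderedAddMonoid (WeightSyn w m) where
  add_le_add_left a b h c := by
    rw [weightSyn_le_iff] at h ⊢
    rw [weightSynKey_add, weightSynKey_add]
    rw [Prod.Lex.le_iff] at h ⊢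
    rcases h with h | ⟨h, h'⟩
    · exact Or.inl (Nat.add_lt_add_right h _)
    · exact Or.inr ⟨congrArg (· + _) h, by
        have := add_le_add_left h' (ofLex (weightSynKey w m c)).2
        simpa using this⟩

instance : WellFoundedLT (WeightSyn w m) :=
  ⟨(InvImage.wf (weightSynKey w m) (wellFounded_lt (α := ℕ ×ₗ m.syn)))⟩

/-- The term order comparing `w`-weights first and breaking ties by `m`. -/
def weightRefine : MonomialOrder.{0, 0} (Fin n) where
  syn := WeightSyn w m
  toSyn := AddEquiv.refl _
  toSyn_monotone a b h := by
    change weightSynKey w m a ≤ weightSynKey w m b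
    rw [Prod.Lex.le_iff]
    have h1 : Finsupp.weight w a ≤ Finsupp.weight w b := by
      rw [← add_tsub_cancel_of_le h, map_add]; exact Nat.le_add_right _ _
    rcases h1.lt_or_eq with h1 | h1
    · exact Or.inl h1
    · exact Or.inr ⟨h1, m.toSyn_monotone h⟩

variable {w m}

lemma weightRefine_lt_iff {a b : Fin n →₀ ℕ} : (weightRefine w m).toSyn a < (weightRefine w m).toSyn b ↔
    Finsupp.weight w a < Finsupp.weight w b ∨
      Finsupp.weight w a = Finsupp.weight w b ∧ m.toSyn a < m.toSyn b :=
  Prod.Lex.lt_iff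

lemma weightRefine_le_iff {a b : Fin n →₀ ℕ} : (weightRefine w m).toSyn a ≤ (weightRefine w m).toSyn b ↔
    Finsupp.weight w a < Finsupp.weight w b ∨
      Finsupp.weight w a = Finsupp.weight w b ∧ m.toSyn a ≤ m.toSyn b :=
  Prod.Lex.le_iff

end Refine

/-! ### Initial forms and the weight initial ideal -/

section Weight

variable {m : MonomialOrder.{0, 0} (Fin n)} {I J : Ideal (MvPolynomial (Fin n) K)}
  {w : Fin n → ℕ}

/-- `I` contains all components of its elements for the grading given by `w`. -/
def HasComponents {M : Type*} [AddCommMonoid M] (w : Fin n → M)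
    (I : Ideal (MvPolynomial (Fin n) K)) : Prop :=
  ∀ f ∈ I, ∀ d, weightedHomogeneousComponent w d f ∈ I

open Classical in
lemma isCHomogeneous_iff {c : Fin n → ℤ} :
    IsCHomogeneous c I ↔ HasComponents (cDegree c) I := by
  let := weightedGradedAlgebra K (cDegree c)
  constructor
  · exact fun h f hf d => weightedHomogeneousComponent_mem_of_mem K (cDegree c) h hf d
  · rintro h d f hf
    have : (DirectSum.decompose (weightedHomogeneousSubmodule K (cDegree c)) f d :
        MvPolynomial (Fin n) K) = weightedHomogeneousComponent (cDegree c) d f :=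
      weightedDecomposition.decompose'_apply K (cDegree c) f d
    rw [this]
    exact h f hf d

lemma weight_le_weightedTotalDegree {f : MvPolynomial (Fin n) K} {v : Fin n →₀ ℕ}
    (hv : v ∈ f.support) : Finsupp.weight w v ≤ weightedTotalDegree w f :=
  le_weightedTotalDegree w hv

lemma coeff_initialForm (f : MvPolynomial (Fin n) K) (v : Fin n →₀ ℕ) :
    coeff v (initialForm w f) =
      if Finsupp.weight w v = weightedTotalDegree w f then coeff v f else 0 := by
  classical
  rw [initialForm, coeff_weightedHomogeneousComponent]

lemma weight_degree_weightRefine (f : MvPolynomial (Fin n) K) :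
    Finsupp.weight w ((weightRefine w m).degree f) = weightedTotalDegree w f := by
  by_cases h0 : f = 0
  · simp [h0, weightedTotalDegree_zero]
  refine le_antisymm (weight_le_weightedTotalDegree (degree_mem_support h0)) ?_
  refine Finset.sup_le fun v hv => ?_
  have := (weightRefine w m).le_degree hv
  rw [weightRefine_le_iff] at this
  rcases this with h | h
  exacts [h.le, h.1.le]

lemma initialForm_ne_zero {f : MvPolynomial (Fin n) K} (h0 : f ≠ 0) : initialForm w f ≠ 0 := by
  intro h
  have := coeff_initialForm (w := w) f ((weightRefine w (lex (σ := Fin n))).degree f)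
  rw [h, if_pos (weight_degree_weightRefine f)] at this
  exact coeff_degree_ne_zero_iff.2 h0 this.symm

lemma degree_initialForm (f : MvPolynomial (Fin n) K) :
    m.degree (initialForm w f) = (weightRefine w m).degree f := by
  by_cases h0 : f = 0
  · simp [h0, initialForm]
  apply m.toSyn.injective
  apply le_antisymm
  · refine m.degree_le_iff.2 fun v hv => ?_
    rw [mem_support_iff, coeff_initialForm] at hv
    split_ifs at hv with h
    · have := (weightRefine w m).le_degree (mem_support_iff.2 hv)
      rw [weightRefine_le_iff, weight_degree_weightRefine, h] at this
      simpa using this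
    · simp at hv
  · apply m.le_degree
    rw [mem_support_iff, coeff_initialForm, if_pos (weight_degree_weightRefine f)]
    exact coeff_degree_ne_zero_iff.2 h0

/-- Each component of an element of `in_w(I)` is the top part of an element of `I`. -/
lemma exists_top_of_mem_weightInitialIdeal {g : MvPolynomial (Fin n) K}
    (hg : g ∈ weightInitialIdeal w I) : ∀ d, ∃ f ∈ I, ∀ v,
      (d < Finsupp.weight w v → coeff v f = 0) ∧
      (Finsupp.weight w v = d → coeff v f = coeff v g) := by
  classical
  rw [weightInitialIdeal, Ideal.span] at hg
  induction hg using Submodule.span_induction with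
  | zero => exact fun d => ⟨0, I.zero_mem, by simp⟩
  | mem g hg =>
    obtain ⟨f, hf, rfl⟩ := hg
    intro d
    by_cases hd : d = weightedTotalDegree w f
    · subst hd
      refine ⟨f, hf, fun v => ⟨fun h => ?_, fun h => ?_⟩⟩
      · by_contra h'
        exact absurd (weight_le_weightedTotalDegree (mem_support_iff.2 h')) (not_le.2 h)
      · rw [coeff_initialForm, if_pos h]
    · refine ⟨0, I.zero_mem, fun v => ⟨by simp, fun h => ?_⟩⟩
      rw [coeff_initialForm, if_neg (h ▸ hd), coeff_zero]
  | add g g' _ _ ih ih' =>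
    intro d
    obtain ⟨f, hf, h⟩ := ih d
    obtain ⟨f', hf', h'⟩ := ih' d
    refine ⟨f + f', I.add_mem hf hf', fun v => ⟨fun hv => ?_, fun hv => ?_⟩⟩
    · simp [(h v).1 hv, (h' v).1 hv]
    · simp [(h v).2 hv, (h' v).2 hv]
  | smul p g _ ih =>
    rw [smul_eq_mul]
    induction p using MvPolynomial.induction_on' with
    | add p q hp hq =>
      intro d
      obtain ⟨f, hf, h⟩ := hp d
      obtain ⟨f', hf', h'⟩ := hq d
      refine ⟨f + f', I.add_mem hf hf', fun v => ⟨fun hv => ?_, fun hv => ?_⟩⟩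
      · simp [(h v).1 hv, (h' v).1 hv]
      · simp [(h v).2 hv, (h' v).2 hv, add_mul]
    | monomial u a =>
      intro d
      -- The part of weight d of x^u g comes from the part of g of weight d - w(u). If w(u) exceeds
      -- d that part is zero, and the truncated subtraction must be avoided.
      by_cases hu : Finsupp.weight w u ≤ d
      · obtain ⟨f, hf, h⟩ := ih (d - Finsupp.weight w u)
        refine ⟨monomial u a * f, I.mul_mem_left _ hf, fun v => ?_⟩
        simp only [coeff_monomial_mul']
        split_ifs with huv
        · have hw : Finsupp.weight w v = Finsupp.weight w u + Finsupp.weight w (v - u) := by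
            rw [← map_add, add_tsub_cancel_of_le huv]
          refine ⟨fun hv => ?_, fun hv => ?_⟩
          · rw [(h (v - u)).1 (by omega), mul_zero]
          · rw [(h (v - u)).2 (by omega)]
        · simp
      · refine ⟨0, I.zero_mem, fun v => ⟨by simp, fun hv => ?_⟩⟩
        rw [coeff_monomial_mul', if_neg, coeff_zero]
        intro huv
        apply hu
        rw [← hv, ← add_tsub_cancel_of_le huv, map_add]
        exact Nat.le_add_right _ _

/-- A nonzero component of an element of `in_w(I)` is the initial form of an element of `I`. -/
lemma exists_initialForm_eq_component {g : MvPolynomial (Fin n) K}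
    (hg : g ∈ weightInitialIdeal w I) (d : ℕ) :
    ∃ f ∈ I, (weightedHomogeneousComponent w d g = 0 ∨
      weightedHomogeneousComponent w d g = initialForm w f) := by
  classical
  obtain ⟨f, hf, h⟩ := exists_top_of_mem_weightInitialIdeal hg d
  refine ⟨f, hf, ?_⟩
  by_cases h0 : weightedHomogeneousComponent w d g = 0
  · exact Or.inl h0
  right
  have hd : weightedTotalDegree w f = d := by
    apply le_antisymm
    · refine Finset.sup_le fun v hv => ?_
      by_contra hlt
      exact mem_support_iff.1 hv ((h v).1 (not_le.1 hlt))
    · obtain ⟨v, hv⟩ := ne_zero_iff.1 h0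
      rw [coeff_weightedHomogeneousComponent] at hv
      split_ifs at hv with hvd
      · rw [← hvd]
        refine weight_le_weightedTotalDegree ?_
        rwa [mem_support_iff, (h v).2 hvd]
      · simp at hv
  ext v
  rw [coeff_weightedHomogeneousComponent, coeff_initialForm, hd]
  split_ifs with hv
  · exact ((h v).2 hv).symm
  · rfl

lemma hasComponents_weightInitialIdeal : HasComponents w (weightInitialIdeal w I) := by
  intro g hg d
  obtain ⟨f, hf, h | h⟩ := exists_initialForm_eq_component hg d
  · rw [h]; exact Ideal.zero_mem _
  · rw [h]; exact Ideal.subset_span ⟨f, hf, rfl⟩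

/-- The leading exponent of g is also that of the component of g in its weight. This component is
the initial form of some f in I, whose leading exponent is that of f for the refined order. -/
lemma leadingExponents_weightInitialIdeal :
    leadingExponents m (weightInitialIdeal w I) = leadingExponents (weightRefine w m) I := by
  classical
  ext s
  constructor
  · rintro ⟨g, hg, h0, rfl⟩
    obtain ⟨f, hf, h⟩ := exists_initialForm_eq_component hg (Finsupp.weight w (m.degree g))
    have hc := coeff_weightedHomogeneousComponent (w := w)
      (n := Finsupp.weight w (m.degree g)) (φ := g) (m.degree g)
    rw [if_pos rfl] at hc
    have hne : weightedHomogeneousComponent w (Finsupp.weight w (m.degree g)) g ≠ 0 := by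
      intro h'
      rw [h'] at hc
      exact m.coeff_degree_ne_zero_iff.2 h0 hc.symm
    have h := h.resolve_left hne
    have hf0 : f ≠ 0 := by
      rintro rfl
      exact hne (by rw [h]; simp [initialForm])
    refine ⟨f, hf, hf0, ?_⟩
    rw [← degree_initialForm, ← h]
    apply m.toSyn.injective
    refine le_antisymm (m.degree_le_degree_of_support_subset ?_) (m.le_degree ?_)
    · intro v hv
      rw [mem_support_iff, coeff_weightedHomogeneousComponent] at hv
      split_ifs at hv
      · exact mem_support_iff.2 hv
      · simp at hv
    · rw [mem_support_iff, hc]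
      exact m.coeff_degree_ne_zero_iff.2 h0
  · rintro ⟨f, hf, h0, rfl⟩
    exact ⟨initialForm w f, Ideal.subset_span ⟨f, hf, rfl⟩, initialForm_ne_zero h0,
      degree_initialForm f⟩

end Weight

/-! ### Monomial ideals and homogeneous reduced elements -/

section Monomial

variable {m m' : MonomialOrder.{0, 0} (Fin n)} {I J : Ideal (MvPolynomial (Fin n) K)}

lemma IsMonomialIdeal.leadingExponents_eq (h : IsMonomialIdeal I) :
    leadingExponents m I = {s | monomial s (1 : K) ∈ I} := by
  classical
  obtain ⟨S, rfl⟩ := h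
  ext s
  constructor
  · rintro ⟨f, hf, h0, rfl⟩
    rw [mem_ideal_span_monomial_image] at hf
    rw [Set.mem_ofPred_eq, mem_ideal_span_monomial_image]
    simpa using hf _ (m.degree_mem_support h0)
  · intro hs
    exact ⟨_, hs, by simp, by simp [degree_monomial]⟩

lemma isMonomialIdeal_of_leadingExponents
    (h : ∀ s ∈ leadingExponents m I, monomial s (1 : K) ∈ I) : IsMonomialIdeal I := by
  refine ⟨leadingExponents m I, (eq_of_le_of_leadingExponents (m := m) ?_ ?_).symm⟩
  · refine Ideal.span_le.2 ?_
    rintro _ ⟨s, hs, rfl⟩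
    exact h s hs
  · intro s hs
    classical
    exact ⟨monomial s 1, Ideal.subset_span ⟨s, hs, rfl⟩, by simp, by simp [degree_monomial]⟩

variable {M : Type*} [AddCommMonoid M] {w : Fin n → M}

/-- In a homogeneous ideal reduced elements are homogeneous. -/
lemma weight_eq_of_mem_support_reducedElement (hI : HasComponents w I) {s v : Fin n →₀ ℕ}
    (hv : v ∈ (reducedElement m I s).support) :
    Finsupp.weight w v = Finsupp.weight w s := by
  classical
  set r := reducedElement m I s with hr
  have hmem : r - weightedHomogeneousComponent w (Finsupp.weight w s) r ∈ I :=
    I.sub_mem (reducedElement_mem s) (hI _ (reducedElement_mem s) _)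
  have h0 : r - weightedHomogeneousComponent w (Finsupp.weight w s) r = 0 := by
    refine eq_zero_of_support_disjoint (m := m) hmem fun u hu huE => ?_
    rw [mem_support_iff, coeff_sub, coeff_weightedHomogeneousComponent] at hu
    split_ifs at hu with h
    · simp at hu
    · rw [sub_zero] at hu
      exact h (by rw [eq_of_mem_support_reducedElement (mem_support_iff.2 hu) huE])
  by_contra h
  have := congrArg (coeff v) h0
  rw [coeff_sub, coeff_weightedHomogeneousComponent, if_neg h, sub_zero, coeff_zero] at this
  exact mem_support_iff.1 hv this

/-- A homogeneous ideal for a grading without comparable exponents in the same degree is monomial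
if all its initial ideals agree. -/
lemma exists_leadingExponents_ne (hI : HasComponents w I)
    (hw : ∀ s v : Fin n →₀ ℕ, Finsupp.weight w s = Finsupp.weight w v → s ≠ v → ∃ i, s i < v i)
    (hmon : ¬ IsMonomialIdeal I) (m : MonomialOrder.{0, 0} (Fin n)) :
    ∃ m' : MonomialOrder.{0, 0} (Fin n), leadingExponents m' I ≠ leadingExponents m I := by
  classical
  by_contra! hall
  refine hmon (isMonomialIdeal_of_leadingExponents (m := m) fun s hs => ?_)
  suffices h : reducedElement m I s = monomial s 1 by
    rw [← h]; exact reducedElement_mem s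
  have hsupp : ∀ v ∈ (reducedElement m I s).support, v = s := by
    intro v hv
    by_contra hvs
    obtain ⟨i, hi⟩ := hw s v (weight_eq_of_mem_support_reducedElement hI hv).symm
      (Ne.symm hvs)
    -- The weight e_i compares the exponents of x_i first, so this order puts v above s although it
    -- should select s.
    have := lt_of_mem_support_reducedElement hs (hall (weightRefine (Pi.single i 1) m)) hv hvs
    rw [weightRefine_lt_iff] at this
    have hwt : ∀ u : Fin n →₀ ℕ, Finsupp.weight (Pi.single i 1 : Fin n → ℕ) u = u i := by
      intro u
      simp [Finsupp.weight_apply, Finsupp.sum_fintype, Pi.single_apply]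
    rw [hwt, hwt] at this
    omega
  ext v
  rw [coeff_monomial]
  split_ifs with h
  · rw [← h, coeff_reducedElement_self hs]
  · by_contra h'
    exact h (hsupp v (mem_support_iff.2 h')).symm

end Monomial

/-! ### Term orders on integer vectors and positive weights -/

section Cone

/-- The positive part of an integer vector. -/
def posPart (x : Fin n → ℤ) : Fin n →₀ ℕ := Finsupp.equivFunOnFinite.symm fun i => (x i).toNat

@[simp] lemma posPart_apply (x : Fin n → ℤ) (i : Fin n) : posPart x i = (x i).toNat := rfl

/-- The integer vectors that are positive for the extension of a term order to `ℤⁿ`. -/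
def IsPositive (m : MonomialOrder.{0, 0} (Fin n)) (x : Fin n → ℤ) : Prop :=
  m.toSyn (posPart (-x)) < m.toSyn (posPart x)

variable {m m' : MonomialOrder.{0, 0} (Fin n)} {x y : Fin n → ℤ}

/-- The pairs (s, v) and (x⁺, x⁻) have the same difference, and translation preserves a term order.
-/
lemma isPositive_iff {s v : Fin n →₀ ℕ} (h : ∀ i, x i = s i - v i) :
    IsPositive m x ↔ m.toSyn v < m.toSyn s := by
  have he : posPart x + v = posPart (-x) + s := by
    ext i
    simp only [Finsupp.add_apply, posPart_apply, Pi.neg_apply]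
    have := h i
    omega
  have he' := congrArg m.toSyn he
  rw [map_add, map_add] at he'
  rw [IsPositive]
  constructor <;> intro hlt <;> by_contra hle
  · have := add_lt_add_of_lt_of_le hlt (not_lt.1 hle)
    rw [he'] at this
    exact lt_irrefl _ this
  · have := add_lt_add_of_le_of_lt (not_lt.1 hle) hlt
    rw [he'] at this
    exact lt_irrefl _ this

lemma IsPositive.add (hx : IsPositive m x) (hy : IsPositive m y) : IsPositive m (x + y) := by
  rw [isPositive_iff (s := posPart x + posPart y) (v := posPart (-x) + posPart (-y))]
  · rw [map_add, map_add]
    exact add_lt_add hx hy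
  · intro i
    simp only [Finsupp.add_apply, posPart_apply, Pi.neg_apply, Pi.add_apply]
    omega

lemma not_isPositive_zero : ¬ IsPositive m (0 : Fin n → ℤ) := by
  simp [IsPositive]

lemma isPositive_or_neg (hx : x ≠ 0) : IsPositive m x ∨ IsPositive m (-x) := by
  rw [IsPositive, IsPositive, neg_neg]
  refine lt_or_gt_of_ne fun h => hx ?_
  funext i
  have := DFunLike.congr_fun (m.toSyn.injective h) i
  simp only [posPart_apply, Pi.neg_apply] at this
  simp only [Pi.zero_apply]
  omega

lemma smul_of_add_closed {P : (Fin n → ℤ) → Prop} (hadd : ∀ x y, P x → P y → P (x + y))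
    (hx : P x) {k : ℤ} (hk : 0 < k) : P (k • x) := by
  induction k, Int.add_one_le_of_lt hk using Int.leInduction with
  | base => simpa using hx
  | succ k hk ih =>
    rw [add_smul, one_smul]
    exact hadd _ _ (ih (by omega)) hx

lemma IsPositive.smul (hx : IsPositive m x) {k : ℤ} (hk : 0 < k) : IsPositive m (k • x) :=
  smul_of_add_closed (P := IsPositive m) (fun _ _ => IsPositive.add) hx hk

/-- A finite set of vectors in a cone without zero lies in an open half space. -/
lemma exists_pos_functional : ∀ {n : ℕ} {P : (Fin n → ℤ) → Prop}
    (_ : ∀ x y, P x → P y → P (x + y)) (_ : ¬ P 0) (D : Finset (Fin n → ℤ)) (_ : ∀ d ∈ D, P d),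
    ∃ w : Fin n → ℚ, ∀ d ∈ D, 0 < ∑ i, w i * d i := by
  classical
  intro n
  induction n with
  | zero =>
    intro P _ h0 D hD
    refine ⟨0, fun d hd => absurd (hD d hd) ?_⟩
    rwa [Subsingleton.elim d 0]
  | succ n ih =>
    intro P hadd h0 D hD
    -- Fourier–Motzkin elimination of coordinate 0: vectors with first entry zero are kept, and each
    -- pair with first entries of opposite sign is combined positively so that these entries cancel.
    obtain ⟨w, hw⟩ := ih (P := fun x => P (Fin.cons 0 x))
      (fun x y hx hy => by
        have := hadd _ _ hx hy
        convert this using 1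
        funext i
        refine Fin.cases ?_ (fun i => ?_) i <;> simp)
      (by
        convert h0 using 2
        funext i
        refine Fin.cases ?_ (fun i => ?_) i <;> simp)
      ((D.filter (fun d => d 0 = 0)).image Fin.tail ∪
        ((D.filter (fun d => 0 < d 0)) ×ˢ (D.filter (fun d => d 0 < 0))).image
          (fun p => (-(p.2 0)) • Fin.tail p.1 + (p.1 0) • Fin.tail p.2))
      (by
        intro d hd
        rw [Finset.mem_union, Finset.mem_image, Finset.mem_image] at hd
        rcases hd with ⟨a, ha, rfl⟩ | ⟨⟨a, b⟩, hab, rfl⟩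
        · rw [Finset.mem_filter] at ha
          have := hD a ha.1
          rwa [← Fin.cons_self_tail a, ha.2] at this
        · rw [Finset.mem_product, Finset.mem_filter, Finset.mem_filter] at hab
          obtain ⟨⟨ha, ha0⟩, hb, hb0⟩ := hab
          dsimp only at ha ha0 hb hb0
          have := hadd _ _ (smul_of_add_closed hadd (hD a ha) (neg_pos.2 hb0))
            (smul_of_add_closed hadd (hD b hb) ha0)
          convert this using 1
          funext i
          refine Fin.cases ?_ (fun i => ?_) i
          · simp; ring
          · simp [Fin.tail])
    have hpair : ∀ x ∈ (D.filter (fun d => 0 < d 0)).image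
          (fun d => -(∑ i, w i * (d (Fin.succ i) : ℚ)) / (d 0 : ℚ)),
        ∀ y ∈ (D.filter (fun d => d 0 < 0)).image
          (fun d => (∑ i, w i * (d (Fin.succ i) : ℚ)) / (-(d 0 : ℚ))), x < y := by
      intro x hx y hy
      rw [Finset.mem_image] at hx hy
      obtain ⟨a, ha, rfl⟩ := hx
      obtain ⟨b, hb, rfl⟩ := hy
      have h := hw _ (Finset.mem_union_right _ (Finset.mem_image_of_mem _
        (Finset.mk_mem_product ha hb)))
      rw [Finset.mem_filter] at ha hb
      have ha0 : (0 : ℚ) < a 0 := by exact_mod_cast ha.2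
      have hb0 : (b 0 : ℚ) < 0 := by exact_mod_cast hb.2
      rw [div_lt_div_iff₀ ha0 (neg_pos.2 hb0)]
      have he : ∑ i, w i * (((-(b 0)) • Fin.tail a + (a 0) • Fin.tail b) i : ℤ) =
          -(b 0 : ℚ) * (∑ i, w i * (a (Fin.succ i) : ℚ)) +
          (a 0 : ℚ) * ∑ i, w i * (b (Fin.succ i) : ℚ) := by
        rw [Finset.mul_sum, Finset.mul_sum, ← Finset.sum_add_distrib]
        refine Finset.sum_congr rfl fun i _ => ?_
        simp only [Fin.tail, Pi.add_apply, Pi.smul_apply, smul_eq_mul]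
        push_cast
        ring
      rw [he] at h
      linarith
    -- The missing weight y must exceed the bounds from vectors with positive first entry and stay
    -- below those from vectors with negative first entry.
    obtain ⟨y, hy1, hy2⟩ := Order.exists_between_finsets _ _ hpair
    refine ⟨Fin.cons y w, fun d hd => ?_⟩
    rw [Fin.sum_univ_succ]
    simp only [Fin.cons_zero, Fin.cons_succ]
    rcases lt_trichotomy (d 0) 0 with h | h | h
    · have := hy2 _ (Finset.mem_image_of_mem _ (Finset.mem_filter.2 ⟨hd, h⟩))
      have h' : (d 0 : ℚ) < 0 := by exact_mod_cast h
      rw [lt_div_iff₀ (neg_pos.2 h')] at this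
      linarith
    · have := hw _ (Finset.mem_union_left _ (Finset.mem_image_of_mem _
        (Finset.mem_filter.2 ⟨hd, h⟩)))
      simpa [h, Fin.tail] using this
    · have := hy1 _ (Finset.mem_image_of_mem _ (Finset.mem_filter.2 ⟨hd, h⟩))
      have h' : (0 : ℚ) < d 0 := by exact_mod_cast h
      rw [div_lt_iff₀ h'] at this
      linarith

/-- Finitely many positive vectors of a term order are positive for some positive weight. -/
lemma exists_weight_of_isPositive (m : MonomialOrder.{0, 0} (Fin n)) (D : Finset (Fin n → ℤ))
    (hD : ∀ d ∈ D, IsPositive m d) :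
    ∃ w : Fin n → ℕ, (∀ i, 0 < w i) ∧ ∀ d ∈ D, 0 < ∑ i, (w i : ℤ) * d i := by
  classical
  -- Adjoining the unit vectors, positive for every term order, makes the weights themselves
  -- positive. Denominators are cleared afterwards.
  obtain ⟨w, hw⟩ := exists_pos_functional (P := IsPositive m) (fun _ _ => IsPositive.add)
    not_isPositive_zero (D ∪ Finset.univ.image (fun i => Pi.single i 1)) (by
      intro d hd
      rw [Finset.mem_union, Finset.mem_image] at hd
      rcases hd with hd | ⟨i, -, rfl⟩
      · exact hD d hd
      · rw [isPositive_iff (s := Finsupp.single i 1) (v := 0)]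
        · rw [map_zero, m.toSyn_lt_iff_ne_zero, Ne, m.toSyn_eq_zero_iff]
          simp
        · intro j
          by_cases h : i = j <;> simp [h, eq_comm])
  have hpos : ∀ i, 0 < w i := by
    intro i
    have := hw (Pi.single i 1)
      (Finset.mem_union_right _ (Finset.mem_image_of_mem _ (Finset.mem_univ i)))
    simpa [Pi.single_apply] using this
  have hN : 0 < ∏ i, (w i).den := Finset.prod_pos fun i _ => (w i).den_pos
  have hint : ∀ i, ∃ a : ℕ, (a : ℚ) = (∏ i, (w i).den : ℕ) * w i := by
    intro i
    refine ⟨(∏ j ∈ Finset.univ.erase i, (w j).den) * (w i).num.toNat, ?_⟩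
    rw [← Finset.mul_prod_erase _ _ (Finset.mem_univ i)]
    have h1 : (((w i).num.toNat : ℤ) : ℚ) = (w i).num := by
      rw [Int.toNat_of_nonneg (Rat.num_nonneg.2 (hpos i).le)]
    have h2 : ((w i).den : ℚ) * w i = (w i).num := Rat.den_mul_eq_num (w i)
    push_cast at h1 ⊢
    rw [h1, ← h2]
    ring
  choose a ha using hint
  refine ⟨a, fun i => ?_, fun d hd => ?_⟩
  · have : (0 : ℚ) < a i := by
      rw [ha]
      exact mul_pos (by exact_mod_cast hN) (hpos i)
    exact_mod_cast this
  · have h := mul_pos (show (0 : ℚ) < (∏ i, (w i).den : ℕ) by exact_mod_cast hN)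
      (hw d (Finset.mem_union_left _ hd))
    rw [Finset.mul_sum] at h
    have : (0 : ℚ) < ∑ i, (a i : ℚ) * d i := by
      refine h.trans_eq (Finset.sum_congr rfl fun i _ => ?_)
      rw [ha]; ring
    exact_mod_cast this

end Cone

/-! ### Nonmonomial edge ideals are edge providing -/

section EdgeIdeal

variable {m m' : MonomialOrder.{0, 0} (Fin n)} {I : Ideal (MvPolynomial (Fin n) K)}
  {c : Fin n → ℤ}

lemma weight_cDegree (s : Fin n →₀ ℕ) :
    Finsupp.weight (cDegree c) s = QuotientAddGroup.mk fun i => (s i : ℤ) := by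
  classical
  induction s using Finsupp.induction_linear with
  | zero => simp; rfl
  | add s t hs ht =>
    rw [map_add, hs, ht, ← QuotientAddGroup.mk_add]
    congr 1
  | single i k =>
    rw [Finsupp.weight_single, cDegree, ← QuotientAddGroup.mk_nsmul]
    congr 1
    funext j
    by_cases h : i = j <;> simp [h, eq_comm]

lemma weight_cDegree_eq_iff {s v : Fin n →₀ ℕ} :
    Finsupp.weight (cDegree c) s = Finsupp.weight (cDegree c) v ↔
      ∃ k : ℤ, ∀ i, (v i : ℤ) - s i = k * c i := by
  rw [weight_cDegree, weight_cDegree, QuotientAddGroup.eq, AddSubgroup.mem_zmultiples_iff]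
  refine exists_congr fun k => ?_
  rw [funext_iff]
  refine forall_congr' fun i => ?_
  simp only [Pi.smul_apply, smul_eq_mul, Pi.add_apply, Pi.neg_apply]
  constructor <;> intro h <;> linarith

lemma exists_lt_of_weight_cDegree_eq (hpos : ∃ i, 0 < c i) (hneg : ∃ i, c i < 0)
    {s v : Fin n →₀ ℕ} (h : Finsupp.weight (cDegree c) s = Finsupp.weight (cDegree c) v)
    (hne : s ≠ v) : ∃ i, s i < v i := by
  obtain ⟨k, hk⟩ := weight_cDegree_eq_iff.1 h
  obtain ⟨i, hi⟩ := hpos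
  obtain ⟨j, hj⟩ := hneg
  rcases lt_trichotomy k 0 with h0 | h0 | h0
  · refine ⟨j, ?_⟩
    have := mul_pos_of_neg_of_neg h0 hj
    have := hk j
    omega
  · refine absurd ?_ hne
    ext l
    have := hk l
    rw [h0, zero_mul] at this
    omega
  · refine ⟨i, ?_⟩
    have := mul_pos h0 hi
    have := hk i
    omega

/-- All terms of a reduced element lie on a line of direction c, which any two orders making c
positive sort alike. -/
lemma leadingExponents_eq_of_isPositive (hI : HasComponents (cDegree c) I)
    (h : IsPositive m c) (h' : IsPositive m' c) : leadingExponents m' I = leadingExponents m I := by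
  refine leadingExponents_eq_of_le_degree (B := leadingExponents m I) subset_rfl
    (fun s hs => ⟨s, hs, le_rfl⟩) fun s hs v hv => ?_
  by_cases hvs : v = s
  · rw [hvs]
  obtain ⟨k, hk⟩ := weight_cDegree_eq_iff.1 (weight_eq_of_mem_support_reducedElement hI hv)
  have hlt := lt_of_mem_support_reducedElement hs rfl hv hvs
  have hk' : ∀ i, (k • c) i = (s i : ℤ) - v i := fun i => (hk i).symm
  have hpos := (isPositive_iff hk').2 hlt
  have hk0 : 0 < k := by
    by_contra hk0
    rcases (not_lt.1 hk0).lt_or_eq with h0 | h0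
    · have := hpos.add (h.smul (neg_pos.2 h0))
      rw [neg_smul, add_neg_cancel] at this
      exact not_isPositive_zero this
    · rw [h0, zero_smul] at hpos
      exact not_isPositive_zero hpos
  exact ((isPositive_iff hk').1 (h'.smul hk0)).le

lemma hasComponents_neg (hI : HasComponents (cDegree c) I) : HasComponents (cDegree (-c)) I := by
  classical
  intro f hf d
  have key : ∀ s v : Fin n →₀ ℕ, Finsupp.weight (cDegree (-c)) s = Finsupp.weight (cDegree (-c)) v ↔
      Finsupp.weight (cDegree c) s = Finsupp.weight (cDegree c) v := by
    intro s v
    rw [weight_cDegree_eq_iff, weight_cDegree_eq_iff]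
    constructor <;> rintro ⟨k, hk⟩ <;> exact ⟨-k, fun i => by rw [hk i]; simp⟩
  -- The two quotient groups are different types, so degrees are matched through an exponent; a
  -- degree attained by none has zero component.
  by_cases h : ∃ s : Fin n →₀ ℕ, Finsupp.weight (cDegree (-c)) s = d
  · obtain ⟨s, rfl⟩ := h
    convert hI f hf (Finsupp.weight (cDegree c) s) using 1
    ext v
    simp only [coeff_weightedHomogeneousComponent, key]
  · have : weightedHomogeneousComponent (R := K) (cDegree (-c)) d f = 0 := by
      ext v
      rw [coeff_weightedHomogeneousComponent, if_neg (fun hv => h ⟨v, hv⟩), coeff_zero]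
    rw [this]
    exact I.zero_mem

theorem isEdgeProviding_of_isEdgeIdeal (hI : IsEdgeIdeal I) (hmon : ¬ IsMonomialIdeal I) :
    IsEdgeProviding I := by
  obtain ⟨c, hpos, hneg, hc⟩ := hI
  rw [isCHomogeneous_iff] at hc
  have m₀ : MonomialOrder.{0, 0} (Fin n) := MonomialOrder.lex
  obtain ⟨m₁, h₁⟩ := exists_leadingExponents_ne hc
    (fun s v h hne => exists_lt_of_weight_cDegree_eq hpos hneg h hne) hmon m₀
  have hc0 : c ≠ 0 := by
    rintro rfl
    obtain ⟨i, hi⟩ := hpos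
    exact lt_irrefl _ hi
  have hc' := hasComponents_neg hc
  rw [IsEdgeProviding, Set.ncard_eq_two]
  refine ⟨initialIdeal m₀ I, initialIdeal m₁ I, fun h => h₁ (initialIdeal_eq_iff.1 h).symm, ?_⟩
  ext J
  simp only [Set.mem_insert_iff, Set.mem_singleton_iff]
  constructor
  · rintro ⟨m, rfl⟩
    rw [initialIdeal_eq_iff, initialIdeal_eq_iff]
    -- The orders `m₀` and `m₁` must give c opposite signs, so `m` agrees in sign with one of them.
    rcases isPositive_or_neg (m := m) hc0 with h | h <;>
    rcases isPositive_or_neg (m := m₀) hc0 with h0 | h0 <;>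
    rcases isPositive_or_neg (m := m₁) hc0 with h1 | h1 <;>
    first
    | exact Or.inl (leadingExponents_eq_of_isPositive hc h0 h)
    | exact Or.inl (leadingExponents_eq_of_isPositive hc' h0 h)
    | exact Or.inr (leadingExponents_eq_of_isPositive hc h1 h)
    | exact Or.inr (leadingExponents_eq_of_isPositive hc' h1 h)
    | exact absurd (leadingExponents_eq_of_isPositive hc h0 h1) h₁
    | exact absurd (leadingExponents_eq_of_isPositive hc' h0 h1) h₁
  · rintro (rfl | rfl)
    exacts [⟨m₀, rfl⟩, ⟨m₁, rfl⟩]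

end EdgeIdeal

/-! ### Antiparallel and primitive integer vectors -/

section Vector

/-- Two vectors on which no functional is simultaneously negative point in opposite directions. -/
lemma antiparallel_of_forall {d e : Fin n → ℤ} (hd : d ≠ 0) (he : e ≠ 0)
    (h : ∀ x : Fin n → ℤ, 0 ≤ x ⬝ᵥ d ∨ 0 ≤ x ⬝ᵥ e) :
    d ⬝ᵥ e < 0 ∧ 0 < e ⬝ᵥ e ∧ (e ⬝ᵥ e) • d = (d ⬝ᵥ e) • e := by
  have nonneg : ∀ x : Fin n → ℤ, 0 ≤ x ⬝ᵥ x := fun x =>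
    Finset.sum_nonneg fun i _ => mul_self_nonneg _
  have pos : ∀ x : Fin n → ℤ, x ≠ 0 → 0 < x ⬝ᵥ x := fun x hx =>
    lt_of_le_of_ne (nonneg x) fun h => hx (dotProduct_self_eq_zero.1 h.symm)
  have ha := pos d hd
  have hb := pos e he
  have hed : e ⬝ᵥ d = d ⬝ᵥ e := dotProduct_comm _ _
  have hff : ((e ⬝ᵥ e) • d - (d ⬝ᵥ e) • e) ⬝ᵥ ((e ⬝ᵥ e) • d - (d ⬝ᵥ e) • e) =
      (e ⬝ᵥ e) * ((d ⬝ᵥ d) * (e ⬝ᵥ e) - (d ⬝ᵥ e) ^ 2) := by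
    simp only [sub_dotProduct, dotProduct_sub, smul_dotProduct, dotProduct_smul, smul_eq_mul, hed]
    ring
  have hD : (d ⬝ᵥ d) * (e ⬝ᵥ e) - (d ⬝ᵥ e) ^ 2 = 0 := by
    refine le_antisymm ?_ (nonneg_of_mul_nonneg_right (hff ▸ nonneg _) hb)
    by_contra hlt
    -- This vector has product -((d·d)(e·e) - (d·e)²) with both d and e, so a positive Gram
    -- determinant contradicts the hypothesis. This leaves the equality case of Cauchy–Schwarz.
    have hx := h (-(((e ⬝ᵥ e) - (d ⬝ᵥ e)) • d + ((d ⬝ᵥ d) - (d ⬝ᵥ e)) • e))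
    simp only [neg_dotProduct, add_dotProduct, smul_dotProduct, smul_eq_mul, hed] at hx
    rcases hx with hx | hx <;> nlinarith
  rw [hD, mul_zero] at hff
  refine ⟨?_, hb, sub_eq_zero.1 (dotProduct_self_eq_zero.1 hff)⟩
  rcases h (-d) with hx | hx
  · rw [neg_dotProduct] at hx
    omega
  · rw [neg_dotProduct] at hx
    refine lt_of_le_of_ne (by omega) fun h0 => ?_
    rw [h0] at hD
    have := mul_pos ha hb
    omega

/-- The integer points of the line through `e` are the multiples of one vector. -/
lemma exists_primitive {e : Fin n → ℤ} (he : e ≠ 0) :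
    ∃ (c : Fin n → ℤ) (g : ℤ), g ≠ 0 ∧ e = g • c ∧
      ∀ (d : Fin n → ℤ) (a b : ℤ), b ≠ 0 → b • d = a • e → ∃ k : ℤ, d = k • c := by
  obtain ⟨i, hi⟩ := Function.ne_iff.1 he
  obtain ⟨c, hc, hc1⟩ := Finset.extract_gcd e ⟨i, Finset.mem_univ i⟩
  refine ⟨c, Finset.univ.gcd e, ?_, ?_, ?_⟩
  · rw [Ne, Finset.gcd_eq_zero_iff]
    exact fun h => hi (h i (Finset.mem_univ i))
  · funext j
    exact hc j (Finset.mem_univ j)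
  · intro d a b hb hde
    set g := Finset.univ.gcd e
    have hj : ∀ j, b * d j = a * g * c j := by
      intro j
      have := congrFun hde j
      simp only [Pi.smul_apply, smul_eq_mul] at this
      rw [this, hc j (Finset.mem_univ j), mul_assoc]
    have hdvd : b ∣ a * g := by
      -- As b divides every a g c_j, it divides their gcd, which is a g up to sign because the
      -- entries of c have gcd 1.
      have h1 : b ∣ Finset.univ.gcd fun j => a * g * c j :=
        Finset.dvd_gcd fun j _ => ⟨d j, (hj j).symm⟩
      have h2 := (Finset.gcd_mul_left' (s := Finset.univ) (f := c) (a * g)).dvd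
      rw [hc1, mul_one] at h2
      exact h1.trans h2
    obtain ⟨k, hk⟩ := hdvd
    refine ⟨k, funext fun j => mul_left_cancel₀ hb ?_⟩
    rw [hj j, hk, Pi.smul_apply, smul_eq_mul, mul_assoc]

/-- The difference of two exponents as an integer vector. -/
def expDiff (s v : Fin n →₀ ℕ) : Fin n → ℤ := fun i => s i - v i

lemma dotProduct_expDiff (w : Fin n → ℕ) (s v : Fin n →₀ ℕ) :
    (fun i => (w i : ℤ)) ⬝ᵥ expDiff s v = Finsupp.weight w s - Finsupp.weight w v := by
  have h : ∀ u : Fin n →₀ ℕ, ((Finsupp.weight w u : ℕ) : ℤ) = ∑ i, (w i : ℤ) * u i := by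
    intro u
    rw [Finsupp.weight_apply, Finsupp.sum_fintype _ _ (by simp)]
    push_cast
    exact Finset.sum_congr rfl fun i _ => by simp [mul_comm]
  rw [h, h, ← Finset.sum_sub_distrib]
  exact Finset.sum_congr rfl fun i _ => mul_sub _ _ _

lemma expDiff_ne_zero {s v : Fin n →₀ ℕ} (h : v ≠ s) : expDiff s v ≠ 0 := by
  intro h0
  refine h (Finsupp.ext fun i => ?_)
  have := congrFun h0 i
  simp only [expDiff, Pi.zero_apply] at this
  omega

lemma exists_pos_neg_of_dotProduct_eq_zero {w : Fin n → ℕ} (hw : ∀ i, 0 < w i) {c : Fin n → ℤ}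
    (hc : c ≠ 0) (h : (fun i => (w i : ℤ)) ⬝ᵥ c = 0) : ∃ i, 0 < c i := by
  by_contra! hle
  have hw' : ∀ i, (0 : ℤ) < w i := fun i => by exact_mod_cast hw i
  refine hc (funext fun i => ?_)
  have := (Finset.sum_eq_zero_iff_of_nonpos fun i _ =>
    mul_nonpos_of_nonneg_of_nonpos (hw' i).le (hle i)).1 h i (Finset.mem_univ i)
  exact (mul_eq_zero.1 this).resolve_left (hw' i).ne'

end Vector

/-! ### Closed Gröbner cones and generators of in_w(I) -/

section Selects

variable {m m₀ : MonomialOrder.{0, 0} (Fin n)} {I : Ideal (MvPolynomial (Fin n) K)}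
  {w : Fin n → ℕ}

/-- The weight `w` lies in the closed Gröbner cone of `I` belonging to the order `m`. -/
def Selects (w : Fin n → ℕ) (m : MonomialOrder.{0, 0} (Fin n))
    (I : Ideal (MvPolynomial (Fin n) K)) : Prop :=
  ∀ s ∈ leadingExponents m I, ∀ v ∈ (reducedElement m I s).support,
    Finsupp.weight w v ≤ Finsupp.weight w s

lemma selects_of_leadingExponents_eq
    (h : leadingExponents (weightRefine w m₀) I = leadingExponents m I) : Selects w m I := by
  intro s hs v hv
  by_cases hvs : v = s
  · rw [hvs]
  rcases weightRefine_lt_iff.1 (lt_of_mem_support_reducedElement hs h hv hvs) with h | h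
  exacts [h.le, h.1.le]

lemma leadingExponents_weightRefine_of_le {B : Set (Fin n →₀ ℕ)} (hB : B ⊆ leadingExponents m I)
    (hgen : ∀ s ∈ leadingExponents m I, ∃ b ∈ B, b ≤ s)
    (h : ∀ s ∈ B, ∀ v ∈ (reducedElement m I s).support,
      Finsupp.weight w v ≤ Finsupp.weight w s) :
    leadingExponents (weightRefine w m) I = leadingExponents m I := by
  refine leadingExponents_eq_of_le_degree hB hgen fun s hs v hv => ?_
  by_cases hvs : v = s
  · rw [hvs]
  rw [weightRefine_le_iff]
  rcases (h s hs v hv).lt_or_eq with h | h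
  · exact Or.inl h
  · exact Or.inr ⟨h, (lt_of_mem_support_reducedElement (hB hs) rfl hv hvs).le⟩

lemma Selects.leadingExponents_eq (h : Selects w m I) :
    leadingExponents (weightRefine w m) I = leadingExponents m I :=
  leadingExponents_weightRefine_of_le (B := leadingExponents m I) subset_rfl
    (fun s hs => ⟨s, hs, le_rfl⟩) h

/-- The part of weight `w(s)` of the reduced element of `s`. -/
def topPart (w : Fin n → ℕ) (m : MonomialOrder.{0, 0} (Fin n))
    (I : Ideal (MvPolynomial (Fin n) K)) (s : Fin n →₀ ℕ) : MvPolynomial (Fin n) K :=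
  weightedHomogeneousComponent w (Finsupp.weight w s) (reducedElement m I s)

lemma coeff_topPart (s v : Fin n →₀ ℕ) : coeff v (topPart w m I s) =
    if Finsupp.weight w v = Finsupp.weight w s then coeff v (reducedElement m I s) else 0 := by
  classical
  rw [topPart, coeff_weightedHomogeneousComponent]

lemma Selects.topPart_eq (h : Selects w m I) {s : Fin n →₀ ℕ} (hs : s ∈ leadingExponents m I) :
    topPart w m I s = initialForm w (reducedElement m I s) := by
  rw [topPart, initialForm]
  congr 2
  refine le_antisymm (weight_le_weightedTotalDegree ?_) (Finset.sup_le (h s hs))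
  rw [mem_support_iff, coeff_reducedElement_self hs]
  exact one_ne_zero

/-- The top parts are initial forms of reduced elements and already realise every leading exponent
of in_w(I). -/
lemma Selects.weightInitialIdeal_eq (h : Selects w m I) :
    weightInitialIdeal w I = Ideal.span (topPart w m I '' leadingExponents m I) := by
  refine (eq_of_le_of_leadingExponents (m := m) ?_ ?_).symm
  · refine Ideal.span_le.2 ?_
    rintro _ ⟨s, hs, rfl⟩
    rw [h.topPart_eq hs]
    exact Ideal.subset_span ⟨_, reducedElement_mem s, rfl⟩
  · rw [leadingExponents_weightInitialIdeal, h.leadingExponents_eq]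
    intro s hs
    refine ⟨_, Ideal.subset_span ⟨s, hs, rfl⟩, ?_, ?_⟩
    · rw [h.topPart_eq hs]
      exact initialForm_ne_zero (reducedElement_ne_zero hs)
    · rw [h.topPart_eq hs, degree_initialForm]
      exact degree_reducedElement hs h.leadingExponents_eq

lemma Selects.exists_weight_eq (h : Selects w m I)
    (hmon : ¬ IsMonomialIdeal (weightInitialIdeal w I)) :
    ∃ s ∈ leadingExponents m I, ∃ v ∈ (reducedElement m I s).support, v ≠ s ∧
      Finsupp.weight w v = Finsupp.weight w s := by
  classical
  by_contra! hne
  refine hmon (isMonomialIdeal_of_leadingExponents (m := m) fun s hs => ?_)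
  rw [leadingExponents_weightInitialIdeal, h.leadingExponents_eq] at hs
  suffices ht : topPart w m I s = monomial s 1 by
    rw [← ht, h.topPart_eq hs]
    exact Ideal.subset_span ⟨_, reducedElement_mem s, rfl⟩
  ext v
  rw [coeff_topPart, coeff_monomial]
  by_cases hvs : s = v
  · subst hvs
    simp [coeff_reducedElement_self hs]
  · rw [if_neg hvs]
    split_ifs with hw
    · by_contra hv
      exact hne s hs v (mem_support_iff.2 hv) (Ne.symm hvs) hw
    · rfl

/-- Dickson's lemma: the minimal leading exponents form an antichain in a well-quasi-order. -/
lemma exists_finite_generators (m : MonomialOrder.{0, 0} (Fin n))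
    (I : Ideal (MvPolynomial (Fin n) K)) :
    ∃ B : Finset (Fin n →₀ ℕ), (B : Set (Fin n →₀ ℕ)) ⊆ leadingExponents m I ∧
      ∀ s ∈ leadingExponents m I, ∃ b ∈ B, b ≤ s := by
  have hfin : {s | Minimal (· ∈ leadingExponents m I) s}.Finite :=
    (setOfPred_minimal_antichain _).finite_of_wellQuasiOrdered wellQuasiOrdered_le
  refine ⟨hfin.toFinset, fun s hs => ?_, fun s hs => ?_⟩
  · exact (hfin.mem_toFinset.1 hs).prop
  · obtain ⟨b, hbs, hb⟩ := exists_minimal_le_of_wellFoundedLT (· ∈ leadingExponents m I) s hs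
    exact ⟨b, hfin.mem_toFinset.2 hb, hbs⟩

end Selects

/-! ### Two cones covering the positive weights -/

section TwoCones

variable {m₁ m₂ : MonomialOrder.{0, 0} (Fin n)} {I : Ideal (MvPolynomial (Fin n) K)}
  {w : Fin n → ℕ}

/-- The positive weight Nw + x lies in one of the cones. Since w vanishes on both differences, x is
nonnegative on the difference belonging to that cone. -/
lemma antiparallel_of_cover (hcover : ∀ w : Fin n → ℕ, (∀ i, 0 < w i) →
      Selects w m₁ I ∨ Selects w m₂ I) (hw : ∀ i, 0 < w i)
    {s v t u : Fin n →₀ ℕ} (hs : s ∈ leadingExponents m₁ I)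
    (hv : v ∈ (reducedElement m₁ I s).support) (hvs : v ≠ s)
    (hwv : Finsupp.weight w v = Finsupp.weight w s) (ht : t ∈ leadingExponents m₂ I)
    (hu : u ∈ (reducedElement m₂ I t).support) (hut : u ≠ t)
    (hwu : Finsupp.weight w u = Finsupp.weight w t) :
    expDiff s v ⬝ᵥ expDiff t u < 0 ∧ 0 < expDiff t u ⬝ᵥ expDiff t u ∧
      (expDiff t u ⬝ᵥ expDiff t u) • expDiff s v =
        (expDiff s v ⬝ᵥ expDiff t u) • expDiff t u := by
  refine antiparallel_of_forall (expDiff_ne_zero hvs) (expDiff_ne_zero hut) fun x => ?_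
  set N : ℤ := 1 + ∑ i, |x i| with hN
  have hpos : ∀ i, 0 < N * w i + x i := by
    intro i
    have h1 : |x i| ≤ ∑ i, |x i| :=
      Finset.single_le_sum (f := fun i => |x i|) (fun i _ => abs_nonneg _) (Finset.mem_univ i)
    have h2 : (1 : ℤ) ≤ w i := by exact_mod_cast hw i
    have h3 := neg_abs_le (x i)
    have h4 : 0 ≤ |x i| := abs_nonneg _
    nlinarith
  have key : ∀ a b : Fin n →₀ ℕ, Finsupp.weight w b = Finsupp.weight w a →
      Finsupp.weight (fun i => (N * w i + x i).toNat) b ≤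
        Finsupp.weight (fun i => (N * w i + x i).toNat) a → 0 ≤ x ⬝ᵥ expDiff a b := by
    intro a b hab hle
    have h1 := dotProduct_expDiff (fun i => (N * w i + x i).toNat) a b
    have h2 : (fun i => (((N * w i + x i).toNat : ℕ) : ℤ)) =
        N • (fun i => (w i : ℤ)) + x := by
      funext i
      rw [Int.toNat_of_nonneg (hpos i).le]
      rfl
    rw [h2, add_dotProduct, smul_dotProduct, dotProduct_expDiff, hab, sub_self, smul_zero,
      zero_add] at h1
    rw [h1, sub_nonneg]
    exact_mod_cast hle
  rcases hcover (fun i => (N * w i + x i).toNat) (fun i => Int.lt_toNat.2 (by simpa using hpos i))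
    with h | h
  · exact Or.inl (key s v hwv (h s hs v hv))
  · exact Or.inr (key t u hwu (h t ht u hu))

/-- One tie for `m₂` fixes the direction c, and every tie for `m₁` is antiparallel to it, so each
top part is homogeneous modulo ℤc. -/
lemma isEdgeIdeal_of_selects (hcover : ∀ w : Fin n → ℕ, (∀ i, 0 < w i) →
      Selects w m₁ I ∨ Selects w m₂ I) (hw : ∀ i, 0 < w i)
    (h₁ : Selects w m₁ I) (h₂ : Selects w m₂ I)
    (hmon : ¬ IsMonomialIdeal (weightInitialIdeal w I)) :
    IsEdgeIdeal (weightInitialIdeal w I) := by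
  classical
  obtain ⟨t, ht, u, hu, hut, hwu⟩ := h₂.exists_weight_eq hmon
  have he := expDiff_ne_zero hut
  obtain ⟨c, g, hg, hgc, hc⟩ := exists_primitive he
  have hc0 : c ≠ 0 := by
    rintro rfl
    rw [smul_zero] at hgc
    exact he hgc
  have hwc : (fun i => (w i : ℤ)) ⬝ᵥ c = 0 := by
    have := dotProduct_expDiff w t u
    rw [hgc, dotProduct_smul, hwu, sub_self, smul_eq_mul] at this
    exact (mul_eq_zero.1 this).resolve_left hg
  refine ⟨c, exists_pos_neg_of_dotProduct_eq_zero hw hc0 hwc, ?_, ?_⟩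
  · obtain ⟨i, hi⟩ := exists_pos_neg_of_dotProduct_eq_zero hw (neg_ne_zero.2 hc0)
      (by rw [dotProduct_neg, hwc, neg_zero])
    exact ⟨i, by simpa using hi⟩
  · rw [IsCHomogeneous, h₁.weightInitialIdeal_eq]
    let := weightedGradedAlgebra K (cDegree c)
    refine Ideal.homogeneous_span _ _ ?_
    rintro _ ⟨s, hs, rfl⟩
    refine ⟨Finsupp.weight (cDegree c) s, ?_⟩
    rw [mem_weightedHomogeneousSubmodule]
    intro v hv
    rw [coeff_topPart] at hv
    split_ifs at hv with hwv
    · by_cases hvs : v = s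
      · rw [hvs]
      obtain ⟨-, hpos, heq⟩ := antiparallel_of_cover hcover hw hs (mem_support_iff.2 hv) hvs hwv
        ht hu hut hwu
      obtain ⟨k, hk⟩ := hc _ _ _ hpos.ne' heq
      exact weight_cDegree_eq_iff.2 ⟨k, fun i => congrFun hk i⟩
    · exact absurd rfl hv

/-- The weight w' is nonnegative on two antiparallel vectors, hence zero on them. -/
lemma weight_eq_of_selects (hcover : ∀ w : Fin n → ℕ, (∀ i, 0 < w i) →
      Selects w m₁ I ∨ Selects w m₂ I) (hw : ∀ i, 0 < w i) {w' : Fin n → ℕ}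
    (h₂ : Selects w m₂ I)
    (hmon : ¬ IsMonomialIdeal (weightInitialIdeal w I))
    (h₁' : Selects w' m₁ I) (h₂' : Selects w' m₂ I) {s v : Fin n →₀ ℕ}
    (hs : s ∈ leadingExponents m₁ I) (hv : v ∈ (reducedElement m₁ I s).support)
    (hwv : Finsupp.weight w v = Finsupp.weight w s) :
    Finsupp.weight w' v = Finsupp.weight w' s := by
  by_cases hvs : v = s
  · rw [hvs]
  obtain ⟨t, ht, u, hu, hut, hwu⟩ := h₂.exists_weight_eq hmon
  obtain ⟨hneg, hpos, heq⟩ := antiparallel_of_cover hcover hw hs hv hvs hwv ht hu hut hwu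
  refine le_antisymm (h₁' s hs v hv) ?_
  have hle : (Finsupp.weight w' u : ℤ) ≤ Finsupp.weight w' t := by exact_mod_cast h₂' t ht u hu
  have := congrArg (fun x => (fun i => (w' i : ℤ)) ⬝ᵥ x) heq
  simp only [dotProduct_smul, dotProduct_expDiff, smul_eq_mul] at this
  have h3 : ((Finsupp.weight w' s : ℕ) : ℤ) ≤ (Finsupp.weight w' v : ℕ) := by
    by_contra hlt
    have h4 := mul_pos hpos (sub_pos.2 (not_le.1 hlt))
    have h5 := mul_nonpos_of_nonpos_of_nonneg hneg.le (sub_nonneg.2 hle)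
    omega
  exact_mod_cast h3

lemma weightInitialIdeal_eq_of_selects (hcover : ∀ w : Fin n → ℕ, (∀ i, 0 < w i) →
      Selects w m₁ I ∨ Selects w m₂ I) {w' : Fin n → ℕ} (hw : ∀ i, 0 < w i) (hw' : ∀ i, 0 < w' i)
    (h₁ : Selects w m₁ I) (h₂ : Selects w m₂ I)
    (hmon : ¬ IsMonomialIdeal (weightInitialIdeal w I))
    (h₁' : Selects w' m₁ I) (h₂' : Selects w' m₂ I)
    (hmon' : ¬ IsMonomialIdeal (weightInitialIdeal w' I)) :
    weightInitialIdeal w I = weightInitialIdeal w' I := by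
  rw [h₁.weightInitialIdeal_eq, h₁'.weightInitialIdeal_eq]
  congr 1
  refine Set.image_congr fun s hs => ?_
  ext v
  rw [coeff_topPart, coeff_topPart]
  by_cases hv : v ∈ (reducedElement m₁ I s).support
  · refine if_congr ⟨fun h => ?_, fun h => ?_⟩ rfl rfl
    · exact weight_eq_of_selects hcover hw h₂ hmon h₁' h₂' hs hv h
    · exact weight_eq_of_selects hcover hw' h₂' hmon' h₁ h₂ hs hv h
  · rw [notMem_support_iff.1 hv, ite_self, ite_self]

/-- Finitely many differences decide whether a weight selects the leading exponents of `m`. -/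
lemma exists_finset_expDiff (m : MonomialOrder.{0, 0} (Fin n))
    (I : Ideal (MvPolynomial (Fin n) K)) :
    ∃ D : Finset (Fin n → ℤ),
      (∀ d ∈ D, IsPositive m d) ∧
      (∀ d ∈ D, ∃ s ∈ leadingExponents m I, ∃ v ∈ (reducedElement m I s).support,
        d = expDiff s v) ∧
      (∀ w : Fin n → ℕ, (∀ d ∈ D, 0 ≤ (fun i => (w i : ℤ)) ⬝ᵥ d) →
        leadingExponents (weightRefine w m) I = leadingExponents m I) ∧
      (∀ (w : Fin n → ℕ) (m₀ : MonomialOrder.{0, 0} (Fin n)),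
        (∀ d ∈ D, 0 < (fun i => (w i : ℤ)) ⬝ᵥ d) →
        leadingExponents (weightRefine w m₀) I = leadingExponents m I) := by
  classical
  obtain ⟨B, hB, hgen⟩ := exists_finite_generators m I
  have hmem : ∀ s ∈ B, ∀ v ∈ (reducedElement m I s).support, v ≠ s → expDiff s v ∈
      B.biUnion fun s => ((reducedElement m I s).support.erase s).image (expDiff s) :=
    fun s hs v hv hvs => Finset.mem_biUnion.2 ⟨s, hs, Finset.mem_image_of_mem _
      (Finset.mem_erase.2 ⟨hvs, hv⟩)⟩
  refine ⟨B.biUnion fun s => ((reducedElement m I s).support.erase s).image (expDiff s),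
    fun d hd => ?_, fun d hd => ?_, fun w hw => ?_, fun w m₀ hw => ?_⟩
  · simp only [Finset.mem_biUnion, Finset.mem_image, Finset.mem_erase] at hd
    obtain ⟨s, hs, v, ⟨hvs, hv⟩, rfl⟩ := hd
    exact (isPositive_iff fun i => rfl).2
      (lt_of_mem_support_reducedElement (hB hs) rfl hv hvs)
  · simp only [Finset.mem_biUnion, Finset.mem_image, Finset.mem_erase] at hd
    obtain ⟨s, hs, v, ⟨hvs, hv⟩, rfl⟩ := hd
    exact ⟨s, hB hs, v, hv, rfl⟩
  · refine leadingExponents_weightRefine_of_le hB hgen fun s hs v hv => ?_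
    by_cases hvs : v = s
    · rw [hvs]
    have := hw _ (hmem s hs v hv hvs)
    rw [dotProduct_expDiff, sub_nonneg] at this
    exact_mod_cast this
  · refine leadingExponents_eq_of_le_degree hB hgen fun s hs v hv => ?_
    by_cases hvs : v = s
    · rw [hvs]
    have := hw _ (hmem s hs v hv hvs)
    rw [dotProduct_expDiff, sub_pos] at this
    exact weightRefine_le_iff.2 (Or.inl (by exact_mod_cast this))

lemma exists_selects_both (hcover : ∀ w : Fin n → ℕ, (∀ i, 0 < w i) →
      Selects w m₁ I ∨ Selects w m₂ I) (hne : leadingExponents m₁ I ≠ leadingExponents m₂ I) :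
    ∃ w : Fin n → ℕ, (∀ i, 0 < w i) ∧ Selects w m₁ I ∧ Selects w m₂ I := by
  obtain ⟨D₁, hpos₁, hform₁, hle₁, -⟩ := exists_finset_expDiff m₁ I
  obtain ⟨D₂, hpos₂, -, -, hlt₂⟩ := exists_finset_expDiff m₂ I
  obtain ⟨w₁, hw₁, hwD₁⟩ := exists_weight_of_isPositive m₁ D₁ hpos₁
  obtain ⟨w₂, hw₂, hwD₂⟩ := exists_weight_of_isPositive m₂ D₂ hpos₂
  set φ₁ : (Fin n → ℤ) → ℤ := fun d => (fun i => (w₁ i : ℤ)) ⬝ᵥ d with hφ₁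
  set φ₂ : (Fin n → ℤ) → ℤ := fun d => (fun i => (w₂ i : ℤ)) ⬝ᵥ d with hφ₂
  -- If `w₂` met all inequalities of the first cone, refining it by `m₁` would give the leading
  -- exponents of both orders.
  have hex : (D₁.filter fun d => φ₂ d < 0).Nonempty := by
    by_contra hemp
    rw [Finset.not_nonempty_iff_eq_empty, Finset.filter_eq_empty_iff] at hemp
    exact hne ((hle₁ w₂ fun d hd => not_lt.1 (hemp hd)).symm.trans (hlt₂ w₂ m₁ hwD₂))
  -- On the way from `w₁` to `w₂`, the inequality with the least ratio is the first to become an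
  -- equality. The weight `w₀` is a multiple of the point where `d₀` vanishes.
  obtain ⟨d₀, hd₀, hmin⟩ := Finset.exists_min_image _
    (fun d => (φ₁ d : ℚ) / (-(φ₂ d : ℚ))) hex
  rw [Finset.mem_filter] at hd₀
  obtain ⟨hd₀, hneg⟩ := hd₀
  have hpos : 0 < φ₁ d₀ := hwD₁ d₀ hd₀
  set w₀ : Fin n → ℕ := fun i => (-φ₂ d₀).toNat * w₁ i + (φ₁ d₀).toNat * w₂ i with hw₀
  have hdot : ∀ d, (fun i => (w₀ i : ℤ)) ⬝ᵥ d = (-φ₂ d₀) * φ₁ d + φ₁ d₀ * φ₂ d := by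
    intro d
    have : (fun i => (w₀ i : ℤ)) = (-φ₂ d₀) • (fun i => (w₁ i : ℤ)) +
        (φ₁ d₀) • (fun i => (w₂ i : ℤ)) := by
      funext i
      simp only [hw₀, Nat.cast_add, Nat.cast_mul, Pi.add_apply, Pi.smul_apply, smul_eq_mul]
      rw [Int.toNat_of_nonneg (by omega), Int.toNat_of_nonneg hpos.le]
    rw [this, add_dotProduct, smul_dotProduct, smul_dotProduct]
    rfl
  have hw₀pos : ∀ i, 0 < w₀ i := fun i =>
    Nat.add_pos_left (Nat.mul_pos (by omega) (hw₁ i)) _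
  have hsel₁ : Selects w₀ m₁ I := by
    refine selects_of_leadingExponents_eq (m₀ := m₁) (hle₁ w₀ fun d hd => ?_)
    rw [hdot]
    have h1 : 0 < φ₁ d := hwD₁ d hd
    by_cases h2 : φ₂ d < 0
    · have h := hmin d (Finset.mem_filter.2 ⟨hd, h2⟩)
      have hq : (φ₂ d : ℚ) < 0 := by exact_mod_cast h2
      have hq₀ : (φ₂ d₀ : ℚ) < 0 := by exact_mod_cast hneg
      rw [div_le_div_iff₀ (neg_pos.2 hq₀) (neg_pos.2 hq)] at h
      have h' : φ₁ d₀ * -φ₂ d ≤ φ₁ d * -φ₂ d₀ := by exact_mod_cast h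
      linarith
    · have h3 := mul_pos (neg_pos.2 hneg) h1
      have h4 := mul_nonneg hpos.le (not_lt.1 h2)
      linarith
  refine ⟨w₀, hw₀pos, hsel₁, fun s hs v hv => ?_⟩
  -- Every k w₀ + w₂ is negative on `d₀`, so it lies outside the first cone and hence in the second;
  -- for large k this forces `w₀` into the second, which is closed.
  have hk : ∀ k : ℕ, 0 ≤ k * (fun i => (w₀ i : ℤ)) ⬝ᵥ expDiff s v + φ₂ (expDiff s v) := by
    intro k
    have hdotk : ∀ d, (fun i => ((k * w₀ i + w₂ i : ℕ) : ℤ)) ⬝ᵥ d =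
        k * (fun i => (w₀ i : ℤ)) ⬝ᵥ d + φ₂ d := by
      intro d
      have : (fun i => ((k * w₀ i + w₂ i : ℕ) : ℤ)) =
          (k : ℤ) • (fun i => (w₀ i : ℤ)) + (fun i => (w₂ i : ℤ)) := by
        funext i
        simp
      rw [this, add_dotProduct, smul_dotProduct]
      rfl
    rw [← hdotk, dotProduct_expDiff, sub_nonneg]
    rcases hcover (fun i => k * w₀ i + w₂ i) (fun i => Nat.add_pos_right _ (hw₂ i)) with h | h
    · exfalso
      obtain ⟨s', hs', v', hv', hd'⟩ := hform₁ d₀ hd₀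
      have h1 := h s' hs' v' hv'
      have h2 := dotProduct_expDiff (fun i => k * w₀ i + w₂ i) s' v'
      rw [← hd', hdotk, hdot] at h2
      have h3 : -φ₂ d₀ * φ₁ d₀ + φ₁ d₀ * φ₂ d₀ = 0 := by ring
      rw [h3, mul_zero, zero_add] at h2
      omega
    · exact_mod_cast h s hs v hv
  have hfin : 0 ≤ (fun i => (w₀ i : ℤ)) ⬝ᵥ expDiff s v := by
    by_contra hlt
    have h1 := hk ((φ₂ (expDiff s v)).natAbs + 1)
    push_cast at h1
    have h2 := le_abs_self (φ₂ (expDiff s v))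
    have h3 := abs_nonneg (φ₂ (expDiff s v))
    nlinarith
  rw [dotProduct_expDiff, sub_nonneg] at hfin
  exact_mod_cast hfin

end TwoCones

/-! ### The edge ideal of an edge providing ideal -/

section EdgeProviding

variable {m₁ m₂ : MonomialOrder.{0, 0} (Fin n)} {I : Ideal (MvPolynomial (Fin n) K)}
  {w : Fin n → ℕ}

lemma leadingExponents_eq_or (h : initialIdeals I = {initialIdeal m₁ I, initialIdeal m₂ I})
    (m : MonomialOrder.{0, 0} (Fin n)) : leadingExponents m I = leadingExponents m₁ I ∨
      leadingExponents m I = leadingExponents m₂ I := by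
  have : initialIdeal m I ∈ initialIdeals I := ⟨m, rfl⟩
  rw [h] at this
  exact this.imp initialIdeal_eq_iff.1 initialIdeal_eq_iff.1

/-- For a positive weight, distinct exponents of equal weight are incomparable, so the nonmonomial
in_w(I) has two different initial ideals. Both are initial ideals of I for refinements of w, which
places w in both cones. -/
lemma selects_both_of_not_isMonomialIdeal
    (h : initialIdeals I = {initialIdeal m₁ I, initialIdeal m₂ I}) (hw : ∀ i, 0 < w i)
    (hmon : ¬ IsMonomialIdeal (weightInitialIdeal w I)) : Selects w m₁ I ∧ Selects w m₂ I := by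
  obtain ⟨m', hm'⟩ := exists_leadingExponents_ne (hasComponents_weightInitialIdeal (w := w))
    (fun s v hsv hne => by
      by_contra! hle
      have hlt : v < s := lt_of_le_of_ne hle (Ne.symm hne)
      obtain ⟨i, hi⟩ : ∃ i, v i < s i := by
        by_contra! h'
        exact hne (le_antisymm h' hle)
      have h1 := dotProduct_expDiff w s v
      rw [hsv, sub_self] at h1
      have hw' : ∀ i, (0 : ℤ) < w i := fun i => by exact_mod_cast hw i
      have h2 := (Finset.sum_eq_zero_iff_of_nonneg fun i _ => mul_nonneg (hw' i).le
        (show 0 ≤ expDiff s v i from sub_nonneg.2 (by exact_mod_cast hle i))).1 h1 i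
        (Finset.mem_univ i)
      have h3 := (mul_eq_zero.1 h2).resolve_left (hw' i).ne'
      simp only [expDiff] at h3
      omega) hmon m₁
  rw [leadingExponents_weightInitialIdeal, leadingExponents_weightInitialIdeal] at hm'
  rcases leadingExponents_eq_or h (weightRefine w m') with h1 | h1 <;>
  rcases leadingExponents_eq_or h (weightRefine w m₁) with h2 | h2
  · exact absurd (h1.trans h2.symm) hm'
  · exact ⟨selects_of_leadingExponents_eq h1, selects_of_leadingExponents_eq h2⟩
  · exact ⟨selects_of_leadingExponents_eq h2, selects_of_leadingExponents_eq h1⟩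
  · exact absurd (h1.trans h2.symm) hm'

theorem exists_edgeIdeal_of_isEdgeProviding (hI : IsEdgeProviding I) :
    ∃ J : Ideal (MvPolynomial (Fin n) K),
      {L | ¬ IsMonomialIdeal L ∧
        ∃ w : Fin n → ℕ, (∀ i, 0 < w i) ∧ L = weightInitialIdeal w I} = {J} ∧
      IsEdgeIdeal J ∧ initialIdeals J = initialIdeals I := by
  obtain ⟨A, B, hAB, hI⟩ := Set.ncard_eq_two.1 hI
  obtain ⟨m₁, rfl⟩ : A ∈ initialIdeals I := by rw [hI]; exact Or.inl rfl
  obtain ⟨m₂, rfl⟩ : B ∈ initialIdeals I := by rw [hI]; exact Or.inr rfl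
  have hne : leadingExponents m₁ I ≠ leadingExponents m₂ I :=
    fun h => hAB (initialIdeal_eq_iff.2 h)
  have hcover : ∀ w : Fin n → ℕ, (∀ i, 0 < w i) → Selects w m₁ I ∨ Selects w m₂ I := fun w _ =>
    (leadingExponents_eq_or hI (weightRefine w m₁)).imp selects_of_leadingExponents_eq
      selects_of_leadingExponents_eq
  obtain ⟨w, hw, h₁, h₂⟩ := exists_selects_both hcover hne
  have hE₁ : leadingExponents m₁ (weightInitialIdeal w I) = leadingExponents m₁ I := by
    rw [leadingExponents_weightInitialIdeal, h₁.leadingExponents_eq]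
  have hE₂ : leadingExponents m₂ (weightInitialIdeal w I) = leadingExponents m₂ I := by
    rw [leadingExponents_weightInitialIdeal, h₂.leadingExponents_eq]
  have hmon : ¬ IsMonomialIdeal (weightInitialIdeal w I) := by
    intro h
    rw [h.leadingExponents_eq] at hE₁ hE₂
    exact hne (hE₁.symm.trans hE₂)
  refine ⟨weightInitialIdeal w I, ?_, isEdgeIdeal_of_selects hcover hw h₁ h₂ hmon, ?_⟩
  · ext L
    constructor
    · rintro ⟨hL, w', hw', rfl⟩
      obtain ⟨h₁', h₂'⟩ := selects_both_of_not_isMonomialIdeal hI hw' hL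
      exact weightInitialIdeal_eq_of_selects hcover hw' hw h₁' h₂' hL h₁ h₂ hmon
    · rintro rfl
      exact ⟨hmon, w, hw, rfl⟩
  · ext L
    constructor
    · rintro ⟨m, rfl⟩
      exact ⟨weightRefine w m, initialIdeal_eq_iff.2 leadingExponents_weightInitialIdeal⟩
    · intro hL
      rw [hI] at hL
      rcases hL with rfl | rfl
      · exact ⟨m₁, initialIdeal_eq_iff.2 hE₁.symm⟩
      · exact ⟨m₂, initialIdeal_eq_iff.2 hE₂.symm⟩

end EdgeProviding

end EdgeIdeals

end

theorem mainTheorem8 {n : ℕ} {K : Type*} [Field K] :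
    (∀ I : Ideal (MvPolynomial (Fin n) K),
      EdgeIdeals.IsEdgeIdeal I → ¬ EdgeIdeals.IsMonomialIdeal I → EdgeIdeals.IsEdgeProviding I) ∧
    (∀ I : Ideal (MvPolynomial (Fin n) K), EdgeIdeals.IsEdgeProviding I →
      ∃ J : Ideal (MvPolynomial (Fin n) K),
        {L | ¬ EdgeIdeals.IsMonomialIdeal L ∧
          ∃ w : Fin n → ℕ, (∀ i, 0 < w i) ∧ L = EdgeIdeals.weightInitialIdeal w I} = {J} ∧
        EdgeIdeals.IsEdgeIdeal J ∧
        EdgeIdeals.initialIdeals J = EdgeIdeals.initialIdeals I) :=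
  ⟨fun _ hI hmon => EdgeIdeals.isEdgeProviding_of_isEdgeIdeal hI hmon,
    fun _ hI => EdgeIdeals.exists_edgeIdeal_of_isEdgeProviding hI⟩
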